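/- Let $k$ be a commutative ring and $A$ an associative unital $k$-algebra. An oriented quantum algebra $(A,\rho,D,U)$ consists of an invertible $\rho\in A\otimes_k A$ satisfying the algebraic Yang--Baxter equation $\rho_{12}\rho_{13}\rho_{23}=\rho_{23}\rho_{13}\rho_{12}$ and commuting $k$-algebra automorphisms $D,U$ of $A$ with $(U\otimes U)\rho=\rho=(D\otimes D)\rho$, such that $(1_A\otimes U)\rho$ and $(D\otimes 1_{A^{op}})\rho^{-1}$ are inverse to each other in $A\otimes A^{op}$. It is standard if $D=1$. Let $T$ be an oriented $1$-$1$ tangle diagram with a single component (a knot with ends), in Morse position. Write $\rho=\sum e\otimes e'$ and $\rho^{-1}=\sum E\otimes E'$ (finite sums). Decorate each positive crossing by $\rho$ and each negative crossing by $\rho^{-1}$, with the first factor on the over strand and the second on the under strand; at a crossing both of whose strands point to the right the factor on the rising strand is in addition changed by $U$, and at a crossing both of whose strands point to the left the factor on the falling strand is changed by $D$. Slide all these beads along the strand to the top of the tangle: a bead $a$ that slides counterclockwise around a clockwise-oriented maximum or a counterclockwise-oriented minimum becomes $U(a)$, one that slides counterclockwise around a counterclockwise-oriented maximum or a clockwise-oriented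 minimum becomes $D(a)$, and sliding clockwise has the inverse effect. Let $w\in A$ be the resulting sum of products, taken in the order of the orientation, let $r$ be the rotation number (in full turns, counterclockwise positive) of the underlying immersed curve, and put $n=-r$. The invariant of $T$ is the expression $\mathrm{Inv}(T)=G^n w$, recorded as the pair $(n,w)$, where $G$ is the flat curl with $GaG^{-1}=UD(a)$ for all $a\in A$. If $(A,\rho,D,U)$ is an oriented quantum algebra, then $(A,\rho,1,DU)$ is a standard oriented quantum algebra, and for every $T$ as above the invariant $\mathrm{Inv}(T)$ computed from $(A,\rho,D,U)$ equals the one computed from $(A,\rho,1,DU)$, whichever expressions of $\rho$ and $\rho^{-1}$ as finite sums are used in the two computations. -/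

import Mathlib

open scoped TensorProduct

namespace KnotAlg

universe u v

/-! ### Oriented quantum algebras -/

section Algebra

variable {k : Type u} [CommRing k] {A : Type v} [Ring A] [Algebra k A]

/-- `ρ₁₂ = ∑ e ⊗ e' ⊗ 1`. -/
noncomputable def place12 : A ⊗[k] A →ₐ[k] A ⊗[k] (A ⊗[k] A) :=
  Algebra.TensorProduct.map (AlgHom.id k A) Algebra.TensorProduct.includeLeft

/-- `ρ₁₃ = ∑ e ⊗ 1 ⊗ e'`. -/
noncomputable def place13 : A ⊗[k] A →ₐ[k] A ⊗[k] (A ⊗[k] A) :=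
  Algebra.TensorProduct.map (AlgHom.id k A) Algebra.TensorProduct.includeRight

/-- `ρ₂₃ = ∑ 1 ⊗ e ⊗ e'`. -/
noncomputable def place23 : A ⊗[k] A →ₐ[k] A ⊗[k] (A ⊗[k] A) :=
  Algebra.TensorProduct.includeRight

/-- `f ⊗ g` on `A ⊗ A`, for algebra automorphisms `f` and `g`. -/
noncomputable def tensorAut (f g : A ≃ₐ[k] A) : A ⊗[k] A →ₐ[k] A ⊗[k] A :=
  Algebra.TensorProduct.map (f : A →ₐ[k] A) (g : A →ₐ[k] A)

/-- The identity map of modules from `A ⊗ A` to the algebra `A ⊗ Aᵒᵖ`. -/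
noncomputable def toTensorOp : A ⊗[k] A →ₗ[k] A ⊗[k] Aᵐᵒᵖ :=
  TensorProduct.map LinearMap.id (MulOpposite.opLinearEquiv k : A ≃ₗ[k] Aᵐᵒᵖ).toLinearMap

/-- `(A, ρ, D, U)` is an oriented quantum algebra. -/
structure IsOrientedQuantumAlgebra (ρ : (A ⊗[k] A)ˣ) (D U : A ≃ₐ[k] A) : Prop where
  yang_baxter : place12 (ρ : A ⊗[k] A) * place13 (ρ : A ⊗[k] A) * place23 (ρ : A ⊗[k] A) =
    place23 (ρ : A ⊗[k] A) * place13 (ρ : A ⊗[k] A) * place12 (ρ : A ⊗[k] A)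
  comm : D * U = U * D
  map_U : tensorAut U U (ρ : A ⊗[k] A) = ρ
  map_D : tensorAut D D (ρ : A ⊗[k] A) = ρ
  mul_inv : toTensorOp (tensorAut 1 U (ρ : A ⊗[k] A)) *
    toTensorOp (tensorAut D 1 ((ρ⁻¹ : (A ⊗[k] A)ˣ) : A ⊗[k] A)) = 1
  inv_mul : toTensorOp (tensorAut D 1 ((ρ⁻¹ : (A ⊗[k] A)ˣ) : A ⊗[k] A)) *
    toTensorOp (tensorAut 1 U (ρ : A ⊗[k] A)) = 1

/-- An oriented quantum algebra is standard if `D` is the identity. -/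
structure IsStandardOrientedQuantumAlgebra (ρ : (A ⊗[k] A)ˣ) (D U : A ≃ₐ[k] A) : Prop
    extends IsOrientedQuantumAlgebra ρ D U where
  standard : D = 1

/-- Signifiers of `ρ` and of `ρ⁻¹`: finite lists of pairs with
`ρ = ∑ e ⊗ e'` and `ρ⁻¹ = ∑ E ⊗ E'`. -/
structure Signifiers (ρ : (A ⊗[k] A)ˣ) where
  pos : List (A × A)
  neg : List (A × A)
  pos_sum : (pos.map fun x => x.1 ⊗ₜ[k] x.2).sum = (ρ : A ⊗[k] A)
  neg_sum : (neg.map fun x => x.1 ⊗ₜ[k] x.2).sum = ((ρ⁻¹ : (A ⊗[k] A)ˣ) : A ⊗[k] A)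

theorem exists_signifier_list (x : A ⊗[k] A) :
    ∃ l : List (A × A), (l.map fun y => y.1 ⊗ₜ[k] y.2).sum = x := by
  induction x with
  | zero => exact ⟨[], by simp⟩
  | tmul a b => exact ⟨[(a, b)], by simp⟩
  | add x y hx hy =>
    obtain ⟨l, hl⟩ := hx
    obtain ⟨m, hm⟩ := hy
    exact ⟨l ++ m, by simp [hl, hm]⟩

theorem nonempty_signifiers (ρ : (A ⊗[k] A)ˣ) : Nonempty (Signifiers ρ) := by
  obtain ⟨l, hl⟩ := exists_signifier_list (ρ : A ⊗[k] A)
  obtain ⟨m, hm⟩ := exists_signifier_list ((ρ⁻¹ : (A ⊗[k] A)ˣ) : A ⊗[k] A)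
  exact ⟨⟨l, m, hl, hm⟩⟩

end Algebra

/-! ### Oriented tangle diagrams

A sign is a Boolean: `true` (`+`) for a strand oriented upwards, `false` (`-`) for a strand
oriented downwards. -/

/-- Oriented elementary tangles.
* `cap b`: a maximum whose left leg has sign `b` (clockwise iff `b = true`).
* `cup b`: a minimum whose left leg has sign `b` (clockwise iff `b = true`).
* `crossing a b o`: the strand `/` between lower left and upper right has sign `a`, the strand `\`
  between lower right and upper left has sign `b`, and `/` is the over strand iff `o = true`. -/
inductive Elementary where
  | cap (b : Bool)
  | cup (b : Bool)
  | crossing (a b o : Bool)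

/-- The signs at the bottom of an elementary tangle, from left to right. -/
def Elementary.source : Elementary → List Bool
  | .cap b => [b, !b]
  | .cup _ => []
  | .crossing a b _ => [a, b]

/-- The signs at the top of an elementary tangle, from left to right. -/
def Elementary.target : Elementary → List Bool
  | .cap _ => []
  | .cup b => [b, !b]
  | .crossing a b _ => [b, a]

/-- An elementary tangle with vertical strands to its left and to its right. -/
structure Slice where
  left : List Bool
  core : Elementary
  right : List Bool

def Slice.source (s : Slice) : List Bool := s.left ++ s.core.source ++ s.right

def Slice.target (s : Slice) : List Bool := s.left ++ s.core.target ++ s.right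

/-- An oriented tangle diagram from `ε` to `ε'` in Morse position: slices stacked from bottom
(level `0`) to top (level `height`), with matching signs. -/
structure TangleDiagram (ε ε' : List Bool) where
  height : ℕ
  level : Fin (height + 1) → List Bool
  slice : Fin height → Slice
  source_eq : ∀ j, (slice j).source = level j.castSucc
  target_eq : ∀ j, (slice j).target = level j.succ
  bottom_eq : level 0 = ε
  top_eq : level (Fin.last height) = ε'

/-- What a strand meets when it runs through a slice. In `crossing a b o t`, the strand is `/` iff
`t = true`. -/
inductive Passage where
  | straight
  | cap (b : Bool)
  | cup (b : Bool)
  | crossing (a b o t : Bool)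

/-- Entering the slice `s` at the `p`-th strand (counted from the left, starting with `0`) of its
bottom (`up = true`) or of its top (`up = false`): what is met, whether the slice is left through
its top, and the position at which it is left. -/
def Slice.through (s : Slice) (up : Bool) (p : ℕ) : Passage × Bool × ℕ :=
  let l := s.left.length
  let m := if up then s.core.source.length else s.core.target.length
  let m' := if up then s.core.target.length else s.core.source.length
  if p < l then (.straight, up, p)
  else if l + m ≤ p then (.straight, up, p - m + m')
  else
    let q := l + (1 - (p - l))
    match s.core with
    | .cap b => (.cap b, false, q)
    | .cup b => (.cup b, true, q)
    | .crossing a b o => (.crossing a b o (up == (p == l)), up, q)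

namespace TangleDiagram

variable {ε ε' : List Bool} (T : TangleDiagram ε ε')

/-- A point of the diagram: a level and the position of a strand at that level. -/
abbrev Point : Type := Fin (T.height + 1) × ℕ

/-- Following the orientation from a point `x`: the slice that is entered, what is met there and the
next point. The value is `none` if the diagram is left at `x` (or if there is no strand at `x`). -/
def step (x : T.Point) : Option (Fin T.height × Passage × T.Point) :=
  match (T.level x.1)[x.2]? with
  | none => none
  | some true =>
    if h : x.1.val < T.height then
      let j : Fin T.height := ⟨x.1.val, h⟩
      let r := (T.slice j).through true x.2
      some (j, r.1, (if r.2.1 then j.succ else j.castSucc, r.2.2))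
    else none
  | some false =>
    if h : 0 < x.1.val then
      let j : Fin T.height := ⟨x.1.val - 1, by omega⟩
      let r := (T.slice j).through false x.2
      some (j, r.1, (if r.2.1 then j.succ else j.castSucc, r.2.2))
    else none

end TangleDiagram

/-- A `1`-`1` tangle diagram of one component (a knot with ends): a diagram with one input and one
output strand, together with its (unique) traversal from end to end along the orientation, which
passes every point of the diagram exactly once. The strand enters at the bottom if `sign = true` and
at the top if `sign = false`. -/
structure KnotWithEnds where
  sign : Bool
  diagram : TangleDiagram [sign] [sign]
  strand : List diagram.Point
  strand_start : strand.head? = some (if sign then 0 else Fin.last diagram.height, 0)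
  strand_end : strand.getLast? = some (if sign then Fin.last diagram.height else 0, 0)
  strand_step : strand.IsChain fun x y => ∃ j π, diagram.step x = some (j, π, y)
  strand_nodup : strand.Nodup
  mem_strand : ∀ x : diagram.Point, x ∈ strand ↔ x.2 < (diagram.level x.1).length

/-! ### Decoration by beads and bead sliding -/

/-- The rotation of a passage: each counterclockwise cap or cup is a half turn `1`,
each clockwise one a half turn `-1`. -/
def Passage.halfTurn : Passage → ℤ
  | .cap b => if b then -1 else 1
  | .cup b => if b then -1 else 1
  | _ => 0

section Beads

variable {k : Type u} [CommRing k] {A : Type v} [Ring A] [Algebra k A]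

/-- The automorphism applied to a bead that slides through a passage along the orientation. A bead
that moves counterclockwise around a clockwise cap or a counterclockwise cup changes by `U`, around
a counterclockwise cap or a clockwise cup by `D`; moving clockwise gives the inverses. -/
def Passage.slide (D U : A ≃ₐ[k] A) : Passage → (A ≃ₐ[k] A)
  | .cap true => U⁻¹
  | .cap false => D
  | .cup true => D⁻¹
  | .cup false => U
  | _ => 1

/-- The bead which the strand acquires in a passage, where `x` is the pair of signifiers chosen at
that crossing (a term of `ρ` or of `ρ⁻¹`): the over strand carries `x.1` and the under strand `x.2`.
If the crossing is horizontal then the bead on the strand `/` is changed by `U` (crossing pointing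
to the right) or by `D` (crossing pointing to the left). -/
def Passage.bead (D U : A ≃ₐ[k] A) (x : A × A) : Passage → A
  | .crossing a b o t =>
    let y := if t = o then x.1 else x.2
    if t = true ∧ a ≠ b then (if a then U y else D y) else y
  | _ => 1

/-- The terms of the decoration of an elementary tangle: `ρ` at a positive crossing, `ρ⁻¹` at a
negative crossing (and a single trivial term if there is no crossing). A crossing with both strands
upwards or both strands downwards is positive iff `/` is over, a horizontal crossing is positive iff
`\` is over. -/
def Signifiers.terms {ρ : (A ⊗[k] A)ˣ} (S : Signifiers ρ) : Elementary → List (A × A)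
  | .crossing a b o => if o = (a == b) then S.pos else S.neg
  | _ => [(1, 1)]

namespace KnotWithEnds

variable (K : KnotWithEnds)

/-- The automorphism for sliding a bead from `x` to the next point. -/
def slideAt (D U : A ≃ₐ[k] A) (x : K.diagram.Point) : A ≃ₐ[k] A :=
  match K.diagram.step x with
  | some (_, π, _) => π.slide D U
  | none => 1

/-- The bead between `x` and the next point, for the choice `β` of a term at every crossing. -/
def beadAt (D U : A ≃ₐ[k] A) (β : Fin K.diagram.height → A × A) (x : K.diagram.Point) : A :=
  match K.diagram.step x with
  | some (j, π, _) => π.bead D U (β j)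
  | none => 1

/-- The product, in the order of the orientation, of all beads of the strand after sliding them to
the top of the tangle, for the choice `β` of a term at every crossing. -/
def word (D U : A ≃ₐ[k] A) (β : Fin K.diagram.height → A × A) : A :=
  if K.sign then
    K.strand.foldl (fun w x => K.slideAt D U x w * K.beadAt D U β x) 1
  else
    K.strand.foldr (fun x w => K.beadAt D U β x * (K.slideAt D U x)⁻¹ w) 1

/-- The number of half turns of the strand; it is even, since the strand ends in the direction in
which it starts. -/
def halfTurns : ℤ :=
  (K.strand.map fun x =>
    match K.diagram.step x with
    | some (_, π, _) => π.halfTurn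
    | none => 0).sum

/-- The expression `Gⁿ w`, recorded as the pair `(n, w)`. The flat curl `G` satisfies
`G a G⁻¹ = U (D a)`, so it makes one clockwise turn, and the underlying immersed curve of a strand
of rotation number `r` is regularly homotopic to `G⁻ʳ`. The algebra part `w` is the sum, over all
choices of a term of `ρ` or `ρ⁻¹` at every crossing, of the products of the beads. -/
def inv {ρ : (A ⊗[k] A)ˣ} (S : Signifiers ρ) (D U : A ≃ₐ[k] A) : ℤ × A :=
  (-(K.halfTurns / 2),
    ∑ σ : ((j : Fin K.diagram.height) → Fin (S.terms (K.diagram.slice j).core).length),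
      K.word D U fun j => (S.terms (K.diagram.slice j).core).get (σ j))

end KnotWithEnds

end Beads

end KnotAlg

/-! The two invariants differ by a change of gauge. For standardness, apply the automorphism `D⁻¹ ⊗
1` of `A ⊗ Aᵒᵖ` to the two inverse relations: `(D ⊗ 1)ρ⁻¹` becomes `ρ⁻¹`, and `(1 ⊗ U)ρ` becomes
`(D⁻¹ ⊗ U)ρ`, which is `(1 ⊗ DU)ρ` because `D ⊗ D` fixes `ρ`.

For the invariant, give each point of the strand a power of `D` depending only on its sign: trivial
where the sign is that of the ends, `D⁻¹` or `D` elsewhere. Across every cap this power changes by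
`D⁻¹` and across every cup by `D`, which is the discrepancy between the slides for `(1, DU)` and
those for `(D, U)` (`Passage.slide_gauge`). The extra automorphisms at horizontal crossings agree
too, once both beads of a crossing are changed by one common power of `D` (`Passage.bead_gauge`).
The factors telescope along the strand and vanish at the ends, so the words agree up to this change
of beads (`word_gauge`).

The word is bilinear in the two beads of a crossing, since each strand of a crossing is passed once;
hence the state sum depends on the lists of terms only through their tensors
(`exists_linearMap_tensor`, `sum_pi_congr_update`). Those tensors, `ρ` and `ρ⁻¹`, are fixed by `D ⊗
D`, which absorbs both the gauge and the choice of signifiers. The rotation number does not involve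
`D` or `U`. -/

namespace KnotAlg

/-! ### Local geometry of slices and crossings -/

/-- The signs of the end points of a passage: the strand has sign `s` before and `s'` after. -/
def Passage.Compat : Passage → Bool → Bool → Prop
  | .straight, s, s' => s' = s
  | .cap _, s, s' => s = true ∧ s' = false
  | .cup _, s, s' => s = false ∧ s' = true
  | .crossing a b _ t, s, s' => s' = s ∧ s = if t then a else b

/-- The signs at the edge of a slice: the bottom if `up = true` and the top otherwise. -/
def Slice.edge (S : Slice) (up : Bool) : List Bool := if up then S.source else S.target

theorem Slice.through_compat (S : Slice) {s : Bool} {p : ℕ} (h : (S.edge s)[p]? = some s) :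
    (S.through s p).1.Compat s (S.through s p).2.1 ∧
      (S.edge (!(S.through s p).2.1))[(S.through s p).2.2]? = some (S.through s p).2.1 := by
  obtain ⟨l, c, r⟩ := S
  by_cases h1 : p < l.length
  · cases s <;> simp_all [Slice.through, Slice.edge, Slice.source, Slice.target, Passage.Compat,
      List.getElem?_append]
  · obtain ⟨q, rfl⟩ := Nat.exists_eq_add_of_le (not_lt.1 h1)
    -- An edge of the core has at most two end points, so offsets `0`, `1` and `≥ 2` from its left
    -- end exhaust the cases.
    rcases q with _ | _ | q <;> cases c <;> cases s <;>
      simp_all [Slice.through, Slice.edge, Slice.source, Slice.target, Elementary.source,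
        Elementary.target, Passage.Compat, List.getElem?_append] <;> grind

/-- The strand `/` is entered on the left from below and on the right from above, and `\` the other
way round; hence the test `t = s`. -/
theorem Slice.core_of_through (S : Slice) {s : Bool} {p : ℕ} {a b o t : Bool}
    (h : (S.through s p).1 = .crossing a b o t) :
    S.core = .crossing a b o ∧
      p = if t = s then S.left.length else S.left.length + 1 := by
  obtain ⟨l, c, r⟩ := S
  cases c <;> simp only [Slice.through] at h <;> split_ifs at h <;>
    simp_all [Elementary.source, Elementary.target] <;> grind

theorem Slice.through_crossing (S : Slice) {a b o : Bool} (hc : S.core = .crossing a b o)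
    (s t : Bool) :
    (S.through s (if t = s then S.left.length else S.left.length + 1)).1 = .crossing a b o t := by
  obtain ⟨l, c, r⟩ := S
  subst hc
  cases s <;> cases t <;> simp [Slice.through, Elementary.source, Elementary.target]

theorem Slice.edge_crossing (S : Slice) {a b o : Bool} (hc : S.core = .crossing a b o)
    (s t : Bool) :
    (S.edge s)[if t = s then S.left.length else S.left.length + 1]? =
      some (if t then a else b) := by
  obtain ⟨l, c, r⟩ := S
  subst hc
  cases s <;> cases t <;> simp [Slice.edge, Slice.source, Slice.target, Elementary.source,
    Elementary.target]

/-! ### Steps of the traversal and entry points of crossings -/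

namespace TangleDiagram

variable {ε ε' : List Bool} (T : TangleDiagram ε ε')

/-- The level at the bottom (`up = true`) or at the top of a slice. -/
def edgeLevel (j : Fin T.height) (up : Bool) : Fin (T.height + 1) :=
  if up then j.castSucc else j.succ

theorem level_edgeLevel (j : Fin T.height) (up : Bool) :
    T.level (T.edgeLevel j up) = (T.slice j).edge up := by
  cases up <;> simp [edgeLevel, Slice.edge, T.source_eq, T.target_eq]

/-- The sign of the strand at a point. -/
def signAt (x : T.Point) : Option Bool := (T.level x.1)[x.2]?

/-- Treats upward and downward steps uniformly, so that later arguments need not unfold `step`. -/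
theorem step_eq_some_iff {x y : T.Point} {j : Fin T.height} {π : Passage} :
    T.step x = some (j, π, y) ↔ ∃ s, T.signAt x = some s ∧ x.1 = T.edgeLevel j s ∧
      (π, y) = (((T.slice j).through s x.2).1,
        T.edgeLevel j (!((T.slice j).through s x.2).2.1), ((T.slice j).through s x.2).2.2) := by
  obtain ⟨i, p⟩ := x
  -- Leaving through the top lands on the edge from which a downward strand would enter, hence the
  -- negation.
  have key : ∀ b : Bool, (if b = true then j.succ else j.castSucc) = T.edgeLevel j (!b) := by
    intro b; cases b <;> rfl
  unfold step signAt
  rcases hs : (T.level i)[p]? with _ | _ | _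
  · simp
  · by_cases h : 0 < i.val
    · rw [dif_pos h]
      constructor
      · intro e
        simp only [Option.some.injEq, Prod.mk.injEq] at e
        obtain ⟨rfl, rfl, rfl⟩ := e
        refine ⟨false, rfl, ?_, ?_⟩
        · simp only [edgeLevel, Fin.ext_iff]; simp; omega
        · simp only [← key]
      · rintro ⟨s, e, h1, h2⟩
        obtain rfl : false = s := by simpa using e
        obtain ⟨j, hj⟩ := j
        obtain rfl : j = i.val - 1 := by
          have := congrArg Fin.val h1
          simp [edgeLevel] at this
          omega
        simp only [← key] at h2
        rw [h2]
    · rw [dif_neg h]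
      simp only [reduceCtorEq, false_iff]
      rintro ⟨s, e, h1, -⟩
      obtain rfl : false = s := by simpa using e
      have := congrArg Fin.val h1
      simp [edgeLevel] at this
      omega
  · by_cases h : i.val < T.height
    · rw [dif_pos h]
      constructor
      · intro e
        simp only [Option.some.injEq, Prod.mk.injEq] at e
        obtain ⟨rfl, rfl, rfl⟩ := e
        refine ⟨true, rfl, ?_, ?_⟩
        · simp [edgeLevel]
        · simp only [← key]
      · rintro ⟨s, e, h1, h2⟩
        obtain rfl : true = s := by simpa using e
        obtain ⟨j, hj⟩ := j
        obtain rfl : j = i.val := by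
          have := congrArg Fin.val h1
          simp [edgeLevel] at this
          omega
        simp only [← key] at h2
        rw [h2]
    · rw [dif_neg h]
      simp only [reduceCtorEq, false_iff]
      rintro ⟨s, e, h1, -⟩
      obtain rfl : true = s := by simpa using e
      have := congrArg Fin.val h1
      simp [edgeLevel] at this
      omega

theorem compat_of_step {x y : T.Point} {j : Fin T.height} {π : Passage}
    (h : T.step x = some (j, π, y)) :
    ∃ s s', T.signAt x = some s ∧ T.signAt y = some s' ∧ π.Compat s s' := by
  obtain ⟨s, hs, hx, e⟩ := T.step_eq_some_iff.1 h
  obtain ⟨rfl, rfl⟩ := Prod.mk.injEq .. ▸ e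
  rw [signAt, hx, level_edgeLevel] at hs
  obtain ⟨h1, h2⟩ := (T.slice j).through_compat hs
  refine ⟨s, _, ?_, ?_, h1⟩
  · rw [signAt, hx, level_edgeLevel, hs]
  · rw [signAt, level_edgeLevel, h2]

theorem core_of_step {x y : T.Point} {j : Fin T.height} {a b o t : Bool}
    (h : T.step x = some (j, .crossing a b o t, y)) : (T.slice j).core = .crossing a b o := by
  obtain ⟨s, -, -, e⟩ := T.step_eq_some_iff.1 h
  exact ((T.slice j).core_of_through (Prod.mk.inj e).1.symm).1

/-- The point at which a strand enters a crossing. -/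
def entry (j : Fin T.height) (s t : Bool) : T.Point :=
  (T.edgeLevel j s, if t = s then (T.slice j).left.length else (T.slice j).left.length + 1)

theorem step_entry {j : Fin T.height} {a b o : Bool} (hc : (T.slice j).core = .crossing a b o)
    (t : Bool) :
    ∃ y, T.step (T.entry j (if t then a else b) t) = some (j, .crossing a b o t, y) := by
  refine ⟨_, T.step_eq_some_iff.2 ⟨if t then a else b, ?_, rfl, Prod.ext ?_ rfl⟩⟩
  · rw [signAt, entry, level_edgeLevel]
    exact (T.slice j).edge_crossing hc _ t
  · exact ((T.slice j).through_crossing hc _ t).symm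

/-- With `step_entry`: each strand of a crossing has a single entry point, so the term chosen there
is read only at the two entries. -/
theorem eq_entry_of_step {x y : T.Point} {j : Fin T.height} {a b o t : Bool}
    (h : T.step x = some (j, .crossing a b o t, y)) :
    x = T.entry j (if t then a else b) t := by
  obtain ⟨s, s', h1, -, -, h2⟩ := T.compat_of_step h
  obtain ⟨r, h3, h4, e⟩ := T.step_eq_some_iff.1 h
  obtain rfl : s = r := by simpa [h1] using h3
  have := ((T.slice j).core_of_through (Prod.mk.inj e).1.symm).2
  exact Prod.ext (h2 ▸ h4) (h2 ▸ this)

end TangleDiagram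


universe u v

variable {k : Type u} [CommRing k] {A : Type v} [Ring A] [Algebra k A]

/-! ### The standard oriented quantum algebra -/

theorem tensorAut_tensorAut (f g f' g' : A ≃ₐ[k] A) (x : A ⊗[k] A) :
    tensorAut f g (tensorAut f' g' x) = tensorAut (f * f') (g * g') x := by
  induction x with
  | zero => simp
  | tmul a b => simp [tensorAut]
  | add x y hx hy => simp [hx, hy]

theorem tensorAut_one (x : A ⊗[k] A) : tensorAut 1 1 x = x := by
  induction x with
  | zero => simp
  | tmul a b => simp [tensorAut]
  | add x y hx hy => simp only [map_add, hx, hy]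

/-- `f ⊗ 1` on `A ⊗ Aᵒᵖ`. -/
noncomputable def leftAut (f : A ≃ₐ[k] A) : A ⊗[k] Aᵐᵒᵖ →ₐ[k] A ⊗[k] Aᵐᵒᵖ :=
  Algebra.TensorProduct.map (f : A →ₐ[k] A) (AlgHom.id k Aᵐᵒᵖ)

theorem leftAut_toTensorOp (f : A ≃ₐ[k] A) (x : A ⊗[k] A) :
    leftAut f (toTensorOp x) = toTensorOp (tensorAut f 1 x) := by
  induction x with
  | zero => simp
  | tmul a b => simp [leftAut, toTensorOp, tensorAut]
  | add x y hx hy => simp [hx, hy]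

/-- If `f ⊗ f` preserves `ρ` then it preserves `ρ⁻¹`. -/
theorem tensorAut_inv_units {ρ : (A ⊗[k] A)ˣ} {f : A ≃ₐ[k] A}
    (h : tensorAut f f (ρ : A ⊗[k] A) = ρ) :
    tensorAut f f ((ρ⁻¹ : (A ⊗[k] A)ˣ) : A ⊗[k] A) = (ρ⁻¹ : (A ⊗[k] A)ˣ) := by
  have h' : Units.map (tensorAut f f : A ⊗[k] A →* A ⊗[k] A) ρ = ρ := Units.ext h
  have := congrArg Units.val (map_inv (Units.map (tensorAut f f : A ⊗[k] A →* A ⊗[k] A)) ρ)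
  rw [h'] at this
  exact this

theorem tensorAut_inv {f : A ≃ₐ[k] A} {x : A ⊗[k] A} (h : tensorAut f f x = x) :
    tensorAut f⁻¹ f⁻¹ x = x := by
  conv_lhs => rw [← h]
  rw [tensorAut_tensorAut, inv_mul_cancel, tensorAut_one]

theorem IsOrientedQuantumAlgebra.standard {ρ : (A ⊗[k] A)ˣ} {D U : A ≃ₐ[k] A}
    (h : IsOrientedQuantumAlgebra ρ D U) : IsStandardOrientedQuantumAlgebra ρ 1 (D * U) := by
  have h1 : tensorAut D⁻¹ 1 (tensorAut 1 U (ρ : A ⊗[k] A)) = tensorAut 1 (D * U) ρ := by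
    conv_rhs => rw [← tensorAut_inv h.map_D]
    rw [tensorAut_tensorAut, tensorAut_tensorAut, h.comm]
    simp
  have h2 : tensorAut D⁻¹ 1 (tensorAut D 1 ((ρ⁻¹ : (A ⊗[k] A)ˣ) : A ⊗[k] A)) =
      tensorAut 1 1 ((ρ⁻¹ : (A ⊗[k] A)ˣ) : A ⊗[k] A) := by
    rw [tensorAut_tensorAut]; simp
  refine ⟨⟨h.yang_baxter, by simp, ?_, tensorAut_one _, ?_, ?_⟩, rfl⟩
  · rw [← tensorAut_tensorAut, h.map_U, h.map_D]
  · rw [← h1, ← h2, ← leftAut_toTensorOp D⁻¹, ← leftAut_toTensorOp D⁻¹, ← map_mul, h.mul_inv, map_one]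
  · rw [← h1, ← h2, ← leftAut_toTensorOp D⁻¹, ← leftAut_toTensorOp D⁻¹, ← map_mul, h.inv_mul, map_one]

/-! ### Change of gauge -/

/-- A power of `D` for a point of sign `σ` on a strand whose ends have sign `s`. -/
def signGauge (D : A ≃ₐ[k] A) : Bool → Bool → (A ≃ₐ[k] A)
  | true, false => D⁻¹
  | false, true => D
  | _, _ => 1

/-- The power of `D` by which the beads at a crossing have to be changed in order to pass from
`(1, DU)` to `(D, U)`. -/
def Elementary.gauge (D : A ≃ₐ[k] A) (s : Bool) : Elementary → (A ≃ₐ[k] A)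
  | .crossing _ b _ => (signGauge D s b)⁻¹
  | _ => 1

theorem Passage.slide_gauge {D U : A ≃ₐ[k] A} (hDU : Commute D U) (s : Bool) {π : Passage}
    {σ σ' : Bool} (h : π.Compat σ σ') :
    π.slide 1 (D * U) * signGauge D s σ = signGauge D s σ' * π.slide D U := by
  have e := hDU.eq
  have e' : U⁻¹ * D⁻¹ = D⁻¹ * U⁻¹ := by rw [← mul_inv_rev, ← mul_inv_rev, e]
  have e'' : D⁻¹ * U⁻¹ * D = U⁻¹ := by rw [← e', mul_assoc, inv_mul_cancel, mul_one]
  cases π with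
  | straight => obtain rfl := h; simp [slide]
  | cap b => obtain ⟨rfl, rfl⟩ := h; cases b <;> cases s <;> simp [slide, signGauge, e', e'']
  | cup b => obtain ⟨rfl, rfl⟩ := h; cases b <;> cases s <;> simp [slide, signGauge, e]
  | crossing a b o t => obtain ⟨rfl, -⟩ := h; simp [slide]

/-- On `\` the two gauges cancel. On `/` they leave `signGauge D s a * (signGauge D s b)⁻¹`, which
is `1` for parallel strands, turns `U` into `DU` at a rightward crossing and `D` into `1` at a
leftward one. -/
theorem Passage.bead_gauge {D U : A ≃ₐ[k] A} (hDU : Commute D U) (s : Bool) {π : Passage}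
    {σ σ' : Bool} (h : π.Compat σ σ') {c : Elementary}
    (hc : ∀ a b o t, π = .crossing a b o t → c = .crossing a b o) (x : A × A) :
    π.bead 1 (D * U) x =
      signGauge D s σ' (π.bead D U (c.gauge D s x.1, c.gauge D s x.2)) := by
  have e : ∀ y, D (U y) = U (D y) := fun y => DFunLike.congr_fun hDU.eq y
  have e1 : ∀ y, D⁻¹ (D y) = y := fun y => D.symm_apply_apply y
  cases π with
  | crossing a b o t =>
    obtain ⟨rfl, rfl⟩ := h
    obtain rfl := hc _ _ _ _ rfl
    cases s <;> cases a <;> cases b <;> cases o <;> cases t <;>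
      simp [bead, Elementary.gauge, signGauge, e, e1]
  | _ => simp [bead]

/-! ### Telescoping of the gauge along the strand -/

namespace KnotWithEnds

variable (K : KnotWithEnds)

/-- Changing the chosen terms by the gauge. -/
def gaugeTerms (D : A ≃ₐ[k] A) (β : Fin K.diagram.height → A × A) :
    Fin K.diagram.height → A × A := fun j =>
  ((K.diagram.slice j).core.gauge D K.sign (β j).1, (K.diagram.slice j).core.gauge D K.sign (β j).2)

variable {D U : A ≃ₐ[k] A} (β : Fin K.diagram.height → A × A)

theorem slideAt_gauge {x y : K.diagram.Point} {j : Fin K.diagram.height} {π : Passage}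
    (h : K.diagram.step x = some (j, π, y)) {σ σ' : Bool} (hx : K.diagram.signAt x = some σ)
    (hy : K.diagram.signAt y = some σ') (hDU : Commute D U) (w : A) :
    K.slideAt 1 (D * U) x (signGauge D K.sign σ w) =
      signGauge D K.sign σ' (K.slideAt D U x w) := by
  obtain ⟨s, s', h1, h2, hc⟩ := K.diagram.compat_of_step h
  obtain rfl : σ = s := by simpa [hx] using h1
  obtain rfl : σ' = s' := by simpa [hy] using h2
  simpa [slideAt, h] using DFunLike.congr_fun (Passage.slide_gauge hDU K.sign hc) w

theorem beadAt_gauge {x y : K.diagram.Point} {j : Fin K.diagram.height} {π : Passage}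
    (h : K.diagram.step x = some (j, π, y)) {σ' : Bool}
    (hy : K.diagram.signAt y = some σ') (hDU : Commute D U) :
    K.beadAt 1 (D * U) β x =
      signGauge D K.sign σ' (K.beadAt D U (K.gaugeTerms D β) x) := by
  obtain ⟨s, s', h1, h2, hc⟩ := K.diagram.compat_of_step h
  obtain rfl : σ' = s' := by simpa [hy] using h2
  simp only [beadAt, h, gaugeTerms]
  refine Passage.bead_gauge hDU K.sign hc ?_ (β j)
  rintro a b o t rfl
  exact K.diagram.core_of_step h

/-- The gauge may be taken at the source instead of the target: crossings preserve the sign and all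
other beads are `1`. The right fold needs this form, since there a bead is not slid through its own
passage. -/
theorem beadAt_gauge' {x y : K.diagram.Point} {j : Fin K.diagram.height} {π : Passage}
    (h : K.diagram.step x = some (j, π, y)) {σ : Bool}
    (hx : K.diagram.signAt x = some σ) (hDU : Commute D U) :
    K.beadAt 1 (D * U) β x =
      signGauge D K.sign σ (K.beadAt D U (K.gaugeTerms D β) x) := by
  obtain ⟨s, s', h1, h2, hc⟩ := K.diagram.compat_of_step h
  obtain rfl : σ = s := by simpa [hx] using h1
  rw [K.beadAt_gauge β h h2 hDU]
  cases π with
  | crossing a b o t => rw [hc.1]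
  | _ => simp [beadAt, h, Passage.bead]

theorem foldl_gauge (hDU : Commute D U) {e : K.diagram.Point} (he : K.diagram.step e = none)
    (hs : K.diagram.signAt e = some K.sign) (l : List K.diagram.Point) :
    ∀ (x : K.diagram.Point) (σ : Bool) (w : A),
      (x :: l).IsChain (fun x y => ∃ j π, K.diagram.step x = some (j, π, y)) →
      (x :: l).getLast? = some e → K.diagram.signAt x = some σ →
      (x :: l).foldl (fun w x => K.slideAt 1 (D * U) x w * K.beadAt 1 (D * U) β x)
          (signGauge D K.sign σ w) =
        (x :: l).foldl (fun w x => K.slideAt D U x w * K.beadAt D U (K.gaugeTerms D β) x) w := by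
  induction l with
  | nil =>
    intro x σ w _ h hx
    obtain rfl : x = e := by simpa using h
    obtain rfl : σ = K.sign := by simpa [hx] using hs
    have : signGauge D K.sign K.sign = 1 := by cases K.sign <;> rfl
    simp [slideAt, beadAt, he, this]
  | cons y l ih =>
    intro x σ w hch h hx
    obtain ⟨⟨j, π, hxy⟩, hch⟩ := List.isChain_cons_cons.1 hch
    obtain ⟨_, σ', -, hy, -⟩ := K.diagram.compat_of_step hxy
    rw [List.foldl_cons, List.foldl_cons (a := x),
      ← ih y σ' _ hch (by simpa using h) hy, K.slideAt_gauge hxy hx hy hDU,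
      K.beadAt_gauge β hxy hy hDU, map_mul]

theorem foldr_gauge (hDU : Commute D U) {e : K.diagram.Point} (he : K.diagram.step e = none)
    (hs : K.diagram.signAt e = some K.sign) (l : List K.diagram.Point) :
    ∀ (x : K.diagram.Point) (σ : Bool),
      (x :: l).IsChain (fun x y => ∃ j π, K.diagram.step x = some (j, π, y)) →
      (x :: l).getLast? = some e → K.diagram.signAt x = some σ →
      (x :: l).foldr (fun x w => K.beadAt 1 (D * U) β x * (K.slideAt 1 (D * U) x)⁻¹ w) 1 =
        signGauge D K.sign σ ((x :: l).foldr
          (fun x w => K.beadAt D U (K.gaugeTerms D β) x * (K.slideAt D U x)⁻¹ w) 1) := by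
  induction l with
  | nil =>
    intro x σ _ h hx
    obtain rfl : x = e := by simpa using h
    simp [beadAt, he]
  | cons y l ih =>
    intro x σ hch h hx
    obtain ⟨⟨j, π, hxy⟩, hch⟩ := List.isChain_cons_cons.1 hch
    obtain ⟨_, σ', -, hy, -⟩ := K.diagram.compat_of_step hxy
    rw [List.foldr_cons, List.foldr_cons (a := x), ih y σ' hch (by simpa using h) hy, map_mul,
      K.beadAt_gauge' β hxy hx hDU]
    congr 1
    set w := List.foldr (fun x w => K.beadAt D U (K.gaugeTerms D β) x * (K.slideAt D U x)⁻¹ w) 1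
      (y :: l)
    -- Sliding forward again removes both inverses and reduces the claim to `slideAt_gauge`.
    apply (K.slideAt 1 (D * U) x).injective
    rw [K.slideAt_gauge hxy hx hy hDU]
    exact ((K.slideAt 1 (D * U) x).apply_symm_apply _).trans
      (congrArg _ ((K.slideAt D U x).apply_symm_apply w).symm)

theorem word_gauge (hDU : Commute D U) :
    K.word 1 (D * U) β = K.word D U (K.gaugeTerms D β) := by
  obtain ⟨l, hl⟩ : ∃ l, K.strand = (if K.sign then 0 else Fin.last K.diagram.height, 0) :: l := by
    have := K.strand_start
    rcases h : K.strand with _ | ⟨x, l⟩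
    · simp [h] at this
    · rw [h] at this; exact ⟨l, by simpa using this⟩
  have hch := K.strand_step
  have hend := K.strand_end
  have hstart : K.diagram.signAt (if K.sign then 0 else Fin.last K.diagram.height, 0) =
      some K.sign := by
    unfold TangleDiagram.signAt
    split_ifs <;> simp [K.diagram.bottom_eq, K.diagram.top_eq]
  have hs : K.diagram.signAt (if K.sign then Fin.last K.diagram.height else 0, 0) =
      some K.sign := by
    unfold TangleDiagram.signAt
    split_ifs <;> simp [K.diagram.bottom_eq, K.diagram.top_eq]
  -- A strand of sign `+` at the last level, or of sign `-` at level `0`, has no slice left to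
  -- enter.
  have he : K.diagram.step (if K.sign then Fin.last K.diagram.height else 0, 0) = none := by
    rcases h : K.diagram.step _ with _ | ⟨j, π, y⟩
    · rfl
    · obtain ⟨s, h1, h2, -⟩ := K.diagram.step_eq_some_iff.1 h
      obtain rfl : K.sign = s := by simpa [hs] using h1
      exfalso
      have h3 := congrArg Fin.val h2
      rcases hK : K.sign <;> simp [TangleDiagram.edgeLevel, hK] at h3
      omega
  rw [hl] at hch hend
  have h1 : signGauge D K.sign K.sign = 1 := by cases K.sign <;> rfl
  have hl1 := K.foldl_gauge β hDU he hs l _ _ 1 hch hend hstart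
  have hr1 := K.foldr_gauge β hDU he hs l _ _ hch hend hstart
  rw [h1] at hl1 hr1
  unfold word
  rw [hl]
  split_ifs at hl1 hr1 ⊢
  · exact hl1
  · exact hr1

end KnotWithEnds

/-! ### Multilinearity of the word in the terms at the crossings -/

/-- As `x₀` occurs only once in the list, freezing the other entries at `f₀` leaves a composite of
linear maps. -/
theorem exists_linearMap_foldr {X : Type*} {M N : Type*} [AddCommGroup M] [Module k M]
    [AddCommGroup N] [Module k N] (φ : X → M →ₗ[k] N →ₗ[k] N) (n : N) (f₀ : X → M) {x₀ : X}
    {l : List X} (hl : l.Nodup) (hx : x₀ ∈ l) :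
    ∃ B : M →ₗ[k] N, ∀ f : X → M, (∀ x ≠ x₀, f x = f₀ x) →
      l.foldr (fun x w => φ x (f x) w) n = B (f x₀) := by
  induction l with
  | nil => simp at hx
  | cons y l ih =>
    obtain ⟨hy, hl⟩ := List.nodup_cons.1 hl
    by_cases h : y = x₀
    · subst h
      refine ⟨(φ y).flip (l.foldr (fun x w => φ x (f₀ x) w) n), fun f hf => ?_⟩
      rw [List.foldr_cons, LinearMap.flip_apply]
      congr 1
      refine List.foldr_ext _ _ _ fun x hxl w => ?_
      rw [hf x (ne_of_mem_of_not_mem hxl hy)]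
    · obtain ⟨B, hB⟩ := ih hl ((List.mem_cons.1 hx).resolve_left (Ne.symm h))
      refine ⟨(φ y (f₀ y)).comp B, fun f hf => ?_⟩
      rw [List.foldr_cons, hB f hf, hf y h]
      rfl

namespace KnotWithEnds

variable (K : KnotWithEnds) (D U : A ≃ₐ[k] A) (β : Fin K.diagram.height → A × A)

theorem exists_linearMap_word {x₀ : K.diagram.Point} (hx : x₀ ∈ K.strand) :
    ∃ B : A →ₗ[k] A, ∀ β', (∀ x ≠ x₀, K.beadAt D U β' x = K.beadAt D U β x) →
      K.word D U β' = B (K.beadAt D U β' x₀) := by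
  unfold word
  split_ifs
  · obtain ⟨B, hB⟩ := exists_linearMap_foldr
      (fun x => (LinearMap.mul k A).flip.compl₂ (K.slideAt D U x).toLinearMap) (1 : A)
      (K.beadAt D U β) (List.nodup_reverse.2 K.strand_nodup) (List.mem_reverse.2 hx)
    refine ⟨B, fun β' h => ?_⟩
    -- For an upward strand the word is a left fold, treated as a right fold over the reversed
    -- strand.
    rw [← hB _ h, List.foldr_reverse]
    rfl
  · obtain ⟨B, hB⟩ := exists_linearMap_foldr
      (fun x => (LinearMap.mul k A).compl₂ (K.slideAt D U x)⁻¹.toLinearMap) (1 : A)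
      (K.beadAt D U β) K.strand_nodup hx
    refine ⟨B, fun β' h => ?_⟩
    rw [← hB _ h]
    rfl

theorem exists_linearMap_beadAt {j : Fin K.diagram.height} {a b o : Bool}
    (hc : (K.diagram.slice j).core = .crossing a b o) (t : Bool) :
    ∃ φ : A →ₗ[k] A, ∀ β, K.beadAt D U β (K.diagram.entry j (if t then a else b) t) =
      φ (if t = o then (β j).1 else (β j).2) := by
  obtain ⟨y, hy⟩ := K.diagram.step_entry hc t
  refine ⟨if t = true ∧ a ≠ b then (if a then U.toLinearMap else D.toLinearMap) else .id,
    fun β => ?_⟩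
  simp only [beadAt, hy, Passage.bead]
  split_ifs <;> rfl

theorem beadAt_update_of_ne {j : Fin K.diagram.height} {a b o : Bool}
    (hc : (K.diagram.slice j).core = .crossing a b o) (t : Bool) {p q : A × A}
    (hpq : if t = o then p.2 = q.2 else p.1 = q.1) {x : K.diagram.Point}
    (hx : x ≠ K.diagram.entry j (if t then a else b) t) :
    K.beadAt D U (Function.update β j p) x = K.beadAt D U (Function.update β j q) x := by
  rcases h : K.diagram.step x with _ | ⟨i, π, y⟩
  · simp [beadAt, h]
  simp only [beadAt, h]
  by_cases hij : i = j
  · subst hij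
    cases π with
    | crossing a' b' o' t' =>
      have := K.diagram.core_of_step h
      rw [hc] at this
      obtain ⟨rfl, rfl, rfl⟩ := Elementary.crossing.inj this
      have htt : t' ≠ t := by
        rintro rfl
        exact hx (K.diagram.eq_entry_of_step h)
      obtain rfl : t' = !t := Bool.eq_not.2 htt
      have e : (if (!t) = o then p.1 else p.2) = if (!t) = o then q.1 else q.2 := by
        cases t <;> cases o <;> simpa using hpq
      simp only [Passage.bead, Function.update_self, e]
    | _ => rfl
  · simp [Function.update_of_ne hij]

theorem exists_linearMap_word_update {j : Fin K.diagram.height} {a b o : Bool}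
    (hc : (K.diagram.slice j).core = .crossing a b o) (t : Bool) (q : A × A) :
    ∃ B : A →ₗ[k] A, ∀ p : A × A, (if t = o then p.2 = q.2 else p.1 = q.1) →
      K.word D U (Function.update β j p) = B (if t = o then p.1 else p.2) := by
  have hmem : K.diagram.entry j (if t then a else b) t ∈ K.strand := by
    obtain ⟨y, hy⟩ := K.diagram.step_entry hc t
    obtain ⟨s, -, hs, -⟩ := K.diagram.compat_of_step hy
    rw [K.mem_strand]
    exact (List.getElem?_eq_some_iff.1 hs).1
  obtain ⟨B, hB⟩ := K.exists_linearMap_word D U (Function.update β j q) hmem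
  obtain ⟨φ, hφ⟩ := K.exists_linearMap_beadAt D U hc t
  refine ⟨B.comp φ, fun p hp => ?_⟩
  rw [hB _ fun x hx => K.beadAt_update_of_ne D U β hc t hp hx, hφ, Function.update_self]
  rfl

/-- The word factors through the tensor product of the two beads at each crossing. -/
theorem exists_linearMap_tensor {j : Fin K.diagram.height} {a b o : Bool}
    (hc : (K.diagram.slice j).core = .crossing a b o) :
    ∃ B : A ⊗[k] A →ₗ[k] A, ∀ p : A × A,
      K.word D U (Function.update β j p) = B (p.1 ⊗ₜ p.2) := by
  have h₁ : ∀ v : A, ∃ B : A →ₗ[k] A, ∀ x, K.word D U (Function.update β j (x, v)) = B x := by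
    intro v
    -- Taking `t = o` varies the over strand; the `0` is a dummy, as only the frozen component of
    -- `q` matters.
    obtain ⟨B, hB⟩ := K.exists_linearMap_word_update D U β hc o (0, v)
    exact ⟨B, fun x => by simpa using hB (x, v) (by simp)⟩
  have h₂ : ∀ x : A, ∃ B : A →ₗ[k] A, ∀ v, K.word D U (Function.update β j (x, v)) = B v := by
    intro x
    obtain ⟨B, hB⟩ := K.exists_linearMap_word_update D U β hc (!o) (x, 0)
    exact ⟨B, fun v => by simpa using hB (x, v) (by simp)⟩
  choose B₁ h₁ using h₁
  choose B₂ h₂ using h₂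
  refine ⟨TensorProduct.lift (LinearMap.mk₂ k
    (fun x v => K.word D U (Function.update β j (x, v))) ?_ ?_ ?_ ?_), fun p => rfl⟩
  · intro x x' v; simp only [h₁, map_add]
  · intro c x v; simp only [h₁, map_smul]
  · intro x v v'; simp only [h₂, map_add]
  · intro c x v; simp only [h₂, map_smul]

end KnotWithEnds

/-! ### Comparison of the state sums -/

theorem sum_pi_fin_succ {α M : Type*} [AddCommMonoid M] {n : ℕ} {ι : Fin (n + 1) → Type*}
    [∀ j, Fintype (ι j)] (p : ∀ j, ι j → α) (W : (Fin (n + 1) → α) → M) :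
    ∑ σ : ∀ j, ι j, W (fun j => p j (σ j)) =
      ∑ i, ∑ σ : ∀ j : Fin n, ι j.succ, W (Fin.cons (p 0 i) fun j => p j.succ (σ j)) := by
  rw [← (Fin.consEquiv ι).sum_comp, Fintype.sum_prod_type]
  refine Fintype.sum_congr _ _ fun i => Fintype.sum_congr _ _ fun σ => congrArg W ?_
  funext j
  refine Fin.cases ?_ (fun j => ?_) j <;> simp [Fin.consEquiv]

/-- The families are exchanged one coordinate at a time: first the tail by induction with the head
fixed, then the head. -/
theorem sum_pi_congr_update {α M : Type*} [AddCommMonoid M] {n : ℕ} {ι ι' : Fin n → Type*}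
    [∀ j, Fintype (ι j)] [∀ j, Fintype (ι' j)] (p : ∀ j, ι j → α) (p' : ∀ j, ι' j → α)
    (W : (Fin n → α) → M)
    (h : ∀ j β, ∑ i, W (Function.update β j (p j i)) = ∑ i, W (Function.update β j (p' j i))) :
    ∑ σ : ∀ j, ι j, W (fun j => p j (σ j)) = ∑ σ : ∀ j, ι' j, W (fun j => p' j (σ j)) := by
  induction n with
  | zero =>
    rw [Fintype.sum_unique, Fintype.sum_unique]
    exact congrArg W (Subsingleton.elim _ _)
  | succ n ih =>
    rw [sum_pi_fin_succ, sum_pi_fin_succ]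
    have h1 : ∀ i, ∑ σ : ∀ j : Fin n, ι j.succ, W (Fin.cons (p 0 i) fun j => p j.succ (σ j)) =
        ∑ σ : ∀ j : Fin n, ι' j.succ, W (Fin.cons (p 0 i) fun j => p' j.succ (σ j)) := fun i =>
      ih (fun j => p j.succ) (fun j => p' j.succ) (fun β => W (Fin.cons (p 0 i) β))
        fun j β => by
          simpa only [Fin.cons_update] using h j.succ (Fin.cons (p 0 i) β)
    simp only [h1]
    rw [Finset.sum_comm, Finset.sum_comm (s := Finset.univ (α := ι' 0))]
    refine Fintype.sum_congr _ _ fun σ => ?_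
    -- The hypothesis at coordinate `0` needs some old value there to overwrite; without one both
    -- head sums are empty.
    cases isEmpty_or_nonempty α with
    | inl hα =>
      have : IsEmpty (ι 0) := ⟨fun i => hα.elim (p 0 i)⟩
      have : IsEmpty (ι' 0) := ⟨fun i => hα.elim (p' 0 i)⟩
      simp
    | inr hα =>
      obtain ⟨c⟩ := hα
      simpa only [Fin.update_cons_zero] using h 0 (Fin.cons c fun j => p' j.succ (σ j))

theorem Signifiers.sum_terms {ρ : (A ⊗[k] A)ˣ} (S S' : Signifiers ρ) (c : Elementary) :
    ((S.terms c).map fun x => x.1 ⊗ₜ[k] x.2).sum =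
      ((S'.terms c).map fun x => x.1 ⊗ₜ[k] x.2).sum := by
  cases c with
  | crossing a b o =>
    simp only [terms]
    split_ifs
    · rw [S.pos_sum, S'.pos_sum]
    · rw [S.neg_sum, S'.neg_sum]
  | _ => rfl

theorem Signifiers.tensorAut_sum_terms {ρ : (A ⊗[k] A)ˣ} (S : Signifiers ρ) {f : A ≃ₐ[k] A}
    (hf : tensorAut f f (ρ : A ⊗[k] A) = ρ) (c : Elementary) :
    tensorAut f f ((S.terms c).map fun x => x.1 ⊗ₜ[k] x.2).sum =
      ((S.terms c).map fun x => x.1 ⊗ₜ[k] x.2).sum := by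
  cases c with
  | crossing a b o =>
    simp only [terms]
    split_ifs
    · rw [S.pos_sum, hf]
    · rw [S.neg_sum, tensorAut_inv_units hf]
  | _ => simp [terms, tensorAut]

theorem tensorAut_gauge {ρ : A ⊗[k] A} {D : A ≃ₐ[k] A} (h : tensorAut D D ρ = ρ) (s : Bool)
    (c : Elementary) : tensorAut (c.gauge D s) (c.gauge D s) ρ = ρ := by
  have h' := tensorAut_inv h
  cases c with
  | crossing a b o =>
    cases s <;> cases b <;> simp [Elementary.gauge, signGauge, h, h', tensorAut_one]
  | _ => exact tensorAut_one ρ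

theorem KnotWithEnds.inv_standard (K : KnotWithEnds) {ρ : (A ⊗[k] A)ˣ} {D U : A ≃ₐ[k] A}
    (hDU : Commute D U) (hD : tensorAut D D (ρ : A ⊗[k] A) = ρ) (S S' : Signifiers ρ) :
    K.inv S D U = K.inv S' 1 (D * U) := by
  refine Prod.ext rfl ?_
  simp only [inv, K.word_gauge _ hDU]
  refine sum_pi_congr_update (fun j i => (S.terms (K.diagram.slice j).core).get i)
    (fun j i => ((K.diagram.slice j).core.gauge D K.sign
        ((S'.terms (K.diagram.slice j).core).get i).1,
      (K.diagram.slice j).core.gauge D K.sign ((S'.terms (K.diagram.slice j).core).get i).2))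
    (K.word D U) fun j β => ?_
  generalize hc : (K.diagram.slice j).core = c
  cases c with
  | crossing a b o =>
    obtain ⟨B, hB⟩ := K.exists_linearMap_tensor D U β hc
    have hsum : ∀ (l : List (A × A)) (f : A × A → A ⊗[k] A),
        ∑ i : Fin l.length, B (f (l.get i)) = B (l.map f).sum := by
      intro l f
      rw [← map_sum, ← List.sum_ofFn]
      congr 2
      exact List.ofFn_getElem_eq_map l f
    simp only [hB]
    -- Both sides are now `B` of a tensor: one is the crossing tensor, the other its image under
    -- `gauge ⊗ gauge`, which fixes it.
    rw [hsum _ fun x => x.1 ⊗ₜ x.2, hsum (S'.terms _) fun x =>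
      Elementary.gauge D K.sign (.crossing a b o) x.1 ⊗ₜ
        Elementary.gauge D K.sign (.crossing a b o) x.2,
      S.sum_terms S', ← S'.tensorAut_sum_terms (tensorAut_gauge hD K.sign (.crossing a b o)),
      map_list_sum, List.map_map]
    rfl
  | _ => simp [Signifiers.terms, Elementary.gauge]; rfl

end KnotAlg

/-- If `(A, ρ, D, U)` is an oriented quantum algebra then `(A, ρ, 1, DU)` is a standard oriented
quantum algebra, and both give the same invariant of knots with ends (whatever signifiers are used
to write out `ρ` and `ρ⁻¹`). -/
theorem mainTheorem4 {k : Type*} [CommRing k] {A : Type*} [Ring A] [Algebra k A]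
    (ρ : (TensorProduct k A A)ˣ) (D U : A ≃ₐ[k] A)
    (h : KnotAlg.IsOrientedQuantumAlgebra ρ D U) :
    KnotAlg.IsStandardOrientedQuantumAlgebra ρ 1 (D * U) ∧
      ∀ (K : KnotAlg.KnotWithEnds) (S S' : KnotAlg.Signifiers ρ),
        K.inv S D U = K.inv S' 1 (D * U) :=
  ⟨h.standard, fun K S S' => K.inv_standard h.comm h.map_D S S'⟩
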